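/- Let $\Omega\subset\mathbb R^n$ be a bounded open set with Lipschitz boundary and let $s\in(0,1)$. Put $\mathcal C\Omega=\mathbb R^n\setminus\Omega$ and $Q(\Omega)=\mathbb R^{2n}\setminus(\mathcal C\Omega)^2$. For $q\in[1,\infty)$ let $$\mathcal X^q(\Omega)=\Big\{u\in L^1_{\rm loc}(\mathbb R^n)\;:\;\iint_{Q(\Omega)}\frac{|u(x)-u(y)|^q}{|x-y|^{n+sq}}\,dx\,dy<\infty\Big\},$$ and define $\tilde{\mathcal E}_s^q:L^1_{\rm loc}(\mathbb R^n)\to[0,+\infty]$ by $$\tilde{\mathcal E}_s^q(u)=\frac1{2q}\iint_{Q(\Omega)}\frac{|u(x)-u(y)|^q}{|x-y|^{n+sq}}\,dx\,dy\ \text{ if }u\in\mathcal X^q(\Omega),\qquad \tilde{\mathcal E}_s^q(u)=+\infty\ \text{ otherwise}.$$ Then $\tilde{\mathcal E}_s^p$ $\Gamma$-converges to $\tilde{\mathcal E}_s^1$ as $p\searrow1$ in the $L^1_{\rm loc}(\mathbb R^n)$-topology. That is, for every sequence $p_k\to1$ with $p_k>1$ and every $u\in L^1_{\rm loc}(\mathbb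 R^n)$: 1. for every sequence $(u_k)\subset L^1_{\rm loc}(\mathbb R^n)$ with $u_k\to u$ in $L^1_{\rm loc}(\mathbb R^n)$, one has $\tilde{\mathcal E}_s^1(u)\le\liminf_{k\to\infty}\tilde{\mathcal E}_s^{p_k}(u_k)$; 2. there exists a sequence $(u_k)\subset L^1_{\rm loc}(\mathbb R^n)$ with $u_k\to u$ in $L^1_{\rm loc}(\mathbb R^n)$ and $\lim_{k\to\infty}\tilde{\mathcal E}_s^{p_k}(u_k)=\tilde{\mathcal E}_s^1(u)$. -/

import Mathlib

open MeasureTheory Filter Topology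
open scoped ENNReal

namespace FracGagliardo

/-- A set `Ω ⊆ ℝⁿ` has Lipschitz boundary: near each boundary point, after choosing an "upward"
unit direction `ν`, the set `Ω` is the strict epigraph of a Lipschitz function `g` of the
orthogonal projection `x - ⟪ν, x⟫ ν` of `x` onto the hyperplane `ν^⊥` (only the values of `g`
on that hyperplane matter). -/
def HasLipschitzBoundary {n : ℕ} (Ω : Set (EuclideanSpace ℝ (Fin n))) : Prop :=
  ∀ x₀ ∈ frontier Ω, ∃ ν : EuclideanSpace ℝ (Fin n), ‖ν‖ = 1 ∧
    ∃ (g : EuclideanSpace ℝ (Fin n) → ℝ) (L : NNReal), LipschitzWith L g ∧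
      ∃ r : ℝ, 0 < r ∧ ∀ x ∈ Metric.ball x₀ r,
        (x ∈ Ω ↔ g (x - inner ℝ ν x • ν) < inner ℝ ν x)

/-- `L¹_loc(ℝⁿ)`. Elements are functions; the topology below and the energies do not
distinguish functions that agree almost everywhere. -/
structure L1Loc (n : ℕ) where
  toFun : EuclideanSpace ℝ (Fin n) → ℝ
  locallyIntegrable : LocallyIntegrable toFun volume

theorem L1Loc.integrable_restrict {n : ℕ} (u : L1Loc n)
    (K : TopologicalSpace.Compacts (EuclideanSpace ℝ (Fin n))) :
    Integrable u.toFun (volume.restrict (K : Set (EuclideanSpace ℝ (Fin n)))) :=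
  u.locallyIntegrable.integrableOn_isCompact K.isCompact

/-- The restriction of `u ∈ L¹_loc(ℝⁿ)` to a compact set `K`, as an element of `L¹(K)`. -/
noncomputable def L1Loc.restrict {n : ℕ} (u : L1Loc n)
    (K : TopologicalSpace.Compacts (EuclideanSpace ℝ (Fin n))) :
    Lp ℝ 1 (volume.restrict (K : Set (EuclideanSpace ℝ (Fin n)))) :=
  Integrable.toL1 u.toFun (u.integrable_restrict K)

/-- The `L¹_loc(ℝⁿ)`-topology: the coarsest topology for which all restrictions
`L¹_loc(ℝⁿ) → L¹(K)`, `K` compact, are continuous. -/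
noncomputable instance {n : ℕ} : TopologicalSpace (L1Loc n) :=
  TopologicalSpace.induced (fun u K => u.restrict K) Pi.topologicalSpace

/-- Convergence in `L¹_loc(ℝⁿ)` is `L¹`-convergence on every compact set. -/
theorem L1Loc.tendsto_iff {n : ℕ} {ι : Type*} {l : Filter ι} {u : ι → L1Loc n} {v : L1Loc n} :
    Tendsto u l (𝓝 v) ↔ ∀ K : Set (EuclideanSpace ℝ (Fin n)), IsCompact K →
      Tendsto (fun k => ∫⁻ x in K, ‖(u k).toFun x - v.toFun x‖ₑ) l (𝓝 0) := by
  rw [nhds_induced, tendsto_comap_iff, tendsto_pi_nhds]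
  have key : ∀ K : TopologicalSpace.Compacts (EuclideanSpace ℝ (Fin n)),
      (Tendsto (fun k => (u k).restrict K) l (𝓝 (v.restrict K)) ↔
        Tendsto (fun k => ∫⁻ x in (K : Set (EuclideanSpace ℝ (Fin n))),
          ‖(u k).toFun x - v.toFun x‖ₑ) l (𝓝 0)) := by
    intro K
    rw [tendsto_iff_edist_tendsto_0]
    refine tendsto_congr fun k => ?_
    rw [L1Loc.restrict, L1Loc.restrict, Integrable.edist_toL1_toL1]
    simp only [edist_eq_enorm_sub]
  constructor
  · intro h K hK
    exact (key ⟨K, hK⟩).1 (h ⟨K, hK⟩)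
  · intro h K
    exact (key K).2 (h K K.isCompact)

/-- `Q(Ω) = ℝ²ⁿ ∖ (∁Ω)²`. -/
def Q {n : ℕ} (Ω : Set (EuclideanSpace ℝ (Fin n))) :
    Set (EuclideanSpace ℝ (Fin n) × EuclideanSpace ℝ (Fin n)) :=
  (Ωᶜ ×ˢ Ωᶜ)ᶜ

/-- The double integral `∬_{Q(Ω)} |u(x) - u(y)|^q / |x - y|^{n + s q} dx dy ∈ [0, ∞]`. -/
noncomputable def gagliardoIntegral {n : ℕ} (Ω : Set (EuclideanSpace ℝ (Fin n))) (s q : ℝ)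
    (u : EuclideanSpace ℝ (Fin n) → ℝ) : ℝ≥0∞ :=
  ∫⁻ z in Q Ω, ENNReal.ofReal (|u z.1 - u z.2| ^ q / ‖z.1 - z.2‖ ^ ((n : ℝ) + s * q))

/-- The class `𝒳^q(Ω)` of all `u ∈ L¹_loc(ℝⁿ)` whose double integral is finite. -/
def X {n : ℕ} (Ω : Set (EuclideanSpace ℝ (Fin n))) (s q : ℝ) : Set (L1Loc n) :=
  {u | gagliardoIntegral Ω s q u.toFun < ∞}

open Classical in
/-- The extended `(s,q)`-energy on `L¹_loc(ℝⁿ)`: `1/(2q)` times the double integral on `𝒳^q(Ω)`,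
and `+∞` elsewhere. -/
noncomputable def extEnergy {n : ℕ} (Ω : Set (EuclideanSpace ℝ (Fin n))) (s q : ℝ)
    (u : L1Loc n) : ℝ≥0∞ :=
  if u ∈ X Ω s q then ENNReal.ofReal (1 / (2 * q)) * gagliardoIntegral Ω s q u.toFun else ∞

/-- (Sequential) Γ-convergence of the functionals `F i : E → [0, ∞]` to `G`, as `i` tends to the
limit described by the filter `l`: along every sequence of parameters tending to `l`,
the liminf inequality holds at each point, and each point has a recovery sequence. -/
def GammaTendsto {E ι : Type*} [TopologicalSpace E] (F : ι → E → ℝ≥0∞) (l : Filter ι)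
    (G : E → ℝ≥0∞) : Prop :=
  ∀ p : ℕ → ι, Tendsto p atTop l →
    (∀ (x : E) (u : ℕ → E), Tendsto u atTop (𝓝 x) →
      G x ≤ liminf (fun k => F (p k) (u k)) atTop) ∧
    (∀ x : E, ∃ u : ℕ → E, Tendsto u atTop (𝓝 x) ∧
      Tendsto (fun k => F (p k) (u k)) atTop (𝓝 (G x)))

end FracGagliardo

/-! The liminf inequality is Fatou's lemma: along a subsequence with a.e. convergence the integrands
converge at almost every pair, since both the power and the kernel depend continuously on the
exponent. As `L¹_loc` convergence sees only bounded sets, this is done on balls, which then exhaust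
ℝⁿ (`energyOn_le_liminf`). The boundary plays no role here.

For recovery it suffices to approximate a `u` of finite `(s,1)`-energy by functions that also have
finite `(s,q)`-energy for some `q > 1`. For such a function the energy is right-continuous in the
exponent at 1 by dominated convergence (`tendsto_energyOn`), and a diagonal choice finishes.
Truncation does not increase the `(s,1)`-energy, so `u` may be taken bounded.

A bounded `u` is mollified inside Ω only and kept unchanged outside
(`exists_approximation_of_abs_le`). The Lipschitz boundary makes the kernel `|x - y|^{-(n+t)}`, `0 <
t < 1`, integrable on `Ω × Ωᶜ`, because `Ω \ (Ω - h)` has volume `O(min(1,|h|))`. Hence cross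
interactions of bounded functions converge by domination, and the extension of `u` by zero has
finite seminorm on all of ℝⁿ. Convolution does not increase that total, while Fatou bounds from
below the part off `Ω × Ω`; so the part on `Ω × Ω` cannot exceed its limit by much. The result is
Lipschitz on Ω and bounded, hence of finite `(s,q)`-energy whenever `q ≥ 1` and `sq < 1`. -/

namespace FracGagliardo

/-! ### Kernel integrability and the volume of boundary layers -/

/-- The singular kernel `‖h‖^{-(n+t)}`, tempered by `min 1 ‖h‖`, is integrable on `ℝⁿ`. -/
theorem lintegral_min_one_norm_div_rpow_lt_top {n : ℕ} (hn : 0 < n) {t : ℝ} (ht0 : 0 < t)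
    (ht1 : t < 1) :
    ∫⁻ h : EuclideanSpace ℝ (Fin n), ENNReal.ofReal (min 1 ‖h‖ / ‖h‖ ^ ((n : ℝ) + t)) < ∞ := by
  have : Nonempty (Fin n) := ⟨⟨0, hn⟩⟩
  have hmeas : Measurable fun y : ℝ => y ^ (n - 1) • (min 1 y / y ^ ((n : ℝ) + t)) := by fun_prop
  have hpow : ∀ y : ℝ, 0 < y → y ^ (n - 1) = y ^ ((n : ℝ) - 1) := fun y hy => by
    rw [← Real.rpow_natCast, Nat.cast_sub hn, Nat.cast_one]
  have h : Integrable (fun h : EuclideanSpace ℝ (Fin n) =>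
      min 1 ‖h‖ / ‖h‖ ^ ((n : ℝ) + t)) volume := by
    refine (integrable_fun_norm_addHaar (E := EuclideanSpace ℝ (Fin n)) volume
      (f := fun y => min 1 y / y ^ ((n : ℝ) + t))).2 ?_
    simp only [finrank_euclideanSpace, Fintype.card_fin]
    -- In polar coordinates the radial density is `y^{-t}` on `(0,1]`, integrable as `t < 1`, and
    -- `y^{-1-t}` beyond 1, integrable as `t > 0`.
    rw [← Set.Ioc_union_Ioi_eq_Ioi (zero_le_one' ℝ), integrableOn_union]
    constructor
    · have h0 : IntegrableOn (fun y : ℝ => y ^ (-t)) (Set.Ioc 0 1) := by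
        rw [← intervalIntegrable_iff_integrableOn_Ioc_of_le zero_le_one]
        exact intervalIntegral.intervalIntegrable_rpow' (by linarith)
      refine h0.congr_fun (fun y hy => ?_) measurableSet_Ioc
      have hy0 : 0 < y := hy.1
      simp only [min_eq_right hy.2, smul_eq_mul, hpow y hy0]
      rw [mul_div_assoc', ← Real.rpow_add_one hy0.ne', ← Real.rpow_sub hy0]
      congr 1; ring
    · have h0 : IntegrableOn (fun y : ℝ => y ^ (-1 - t)) (Set.Ioi 1) :=
        integrableOn_Ioi_rpow_of_lt (by linarith) one_pos
      refine h0.congr_fun (fun y hy => ?_) measurableSet_Ioi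
      have hy1 : 1 < y := hy
      have hy0 : 0 < y := by linarith
      simp only [min_eq_left hy1.le, smul_eq_mul, hpow y hy0]
      rw [mul_div_assoc', mul_one, ← Real.rpow_sub hy0]
      congr 1; ring
  exact h.lintegral_lt_top

/-- If `φ` increases at unit speed in the direction `ν`, then the part of a ball where
`0 < φ ≤ ε` has volume `O(ε)`. -/
theorem volume_strip_le {n : ℕ} {φ : EuclideanSpace ℝ (Fin n) → ℝ} (hφ : Continuous φ)
    {ν : EuclideanSpace ℝ (Fin n)} (hν : ‖ν‖ = 1) (hφν : ∀ x (t : ℝ), φ (x + t • ν) = φ x + t)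
    (x₀ : EuclideanSpace ℝ (Fin n)) (r : ℝ) {ε : ℝ} (hε : 0 < ε) :
    volume (Metric.ball x₀ r ∩ {x | 0 < φ x ∧ φ x ≤ ε}) ≤
      volume (Metric.ball x₀ (r + 1)) * ENNReal.ofReal ε := by
  set S := Metric.ball x₀ r ∩ {x | 0 < φ x ∧ φ x ≤ ε} with hS
  have hSm : MeasurableSet S := Metric.isOpen_ball.measurableSet.inter
    ((isOpen_lt continuous_const hφ).measurableSet.inter
      (isClosed_le hφ continuous_const).measurableSet)
  -- The translates of the strip by `kεν`, `0 ≤ k ≤ N`, lie in disjoint layers `kε < φ ≤ (k+1)ε`.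
  -- Since `Nε ≤ 1` they stay in the ball enlarged by 1, and `N + 1 > 1/ε` makes their number large
  -- enough.
  set N := ⌊1 / ε⌋₊
  let T : ℕ → Set (EuclideanSpace ℝ (Fin n)) := fun k => (fun x => x + (-(k * ε)) • ν) ⁻¹' S
  have hTm : ∀ k, MeasurableSet (T k) := fun k => hSm.preimage (measurable_add_const _)
  have hTv : ∀ k, volume (T k) = volume S := fun k => measure_preimage_add_right _ _ _
  have hTφ : ∀ k x, x ∈ T k → k * ε < φ x ∧ φ x ≤ k * ε + ε := by
    intro k x hx
    have := hx.2
    simp only [Set.mem_ofPred_eq, hφν] at this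
    constructor <;> linarith
  have hdisj : Set.PairwiseDisjoint (↑(Finset.range (N + 1))) T := by
    intro i _ j _ hij
    refine Set.disjoint_left.2 fun x hi hj => hij ?_
    have h1 := hTφ i x hi
    have h2 := hTφ j x hj
    have h3 : (i : ℝ) < j + 1 := by
      by_contra! h; nlinarith
    have h4 : (j : ℝ) < i + 1 := by
      by_contra! h; nlinarith
    norm_cast at h3 h4
    omega
  have hsub : (⋃ k ∈ Finset.range (N + 1), T k) ⊆ Metric.ball x₀ (r + 1) := by
    refine Set.iUnion₂_subset fun k hk x hx => ?_
    have hk' : (k : ℝ) ≤ 1 / ε :=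
      le_trans (by exact_mod_cast Nat.lt_succ_iff.1 (Finset.mem_range.1 hk))
        (Nat.floor_le (by positivity))
    have hkε : (k : ℝ) * ε ≤ 1 := (le_div_iff₀ hε).1 hk'
    have h1 : dist (x + (-(k * ε)) • ν) x₀ < r := hx.1
    have h2 : dist x (x + (-(k * ε)) • ν) ≤ 1 := by
      rw [dist_self_add_right, norm_smul, hν, norm_neg, Real.norm_of_nonneg (by positivity)]
      linarith
    have := dist_triangle x (x + (-(k * ε)) • ν) x₀
    rw [Metric.mem_ball]; linarith
  have hcard : ((N + 1 : ℕ) : ℝ≥0∞) * volume S ≤ volume (Metric.ball x₀ (r + 1)) := by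
    refine le_trans (le_of_eq ?_) (measure_mono hsub)
    rw [measure_biUnion_finset hdisj fun k _ => hTm k]
    simp [hTv]
  have hN : 1 ≤ ENNReal.ofReal ε * ((N + 1 : ℕ) : ℝ≥0∞) := by
    rw [← ENNReal.ofReal_natCast, ← ENNReal.ofReal_mul hε.le, ENNReal.one_le_ofReal]
    have := Nat.lt_floor_add_one (1 / ε)
    rw [div_lt_iff₀ hε] at this
    push_cast; rw [mul_comm]; exact this.le
  calc volume S ≤ (ENNReal.ofReal ε * ((N + 1 : ℕ) : ℝ≥0∞)) * volume S := le_mul_of_one_le_left' hN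
    _ = (((N + 1 : ℕ) : ℝ≥0∞) * volume S) * ENNReal.ofReal ε := by ring
    _ ≤ _ := by gcongr

/-- The segment from `x` to `x + h` is connected, so if it missed the frontier it would stay in the
open set `Ω`. -/
theorem exists_mem_frontier_dist_le {n : ℕ} {Ω : Set (EuclideanSpace ℝ (Fin n))} (hΩ : IsOpen Ω)
    {x h : EuclideanSpace ℝ (Fin n)} (hx : x ∈ Ω) (hxh : x + h ∉ Ω) :
    ∃ z ∈ frontier Ω, dist x z ≤ ‖h‖ := by
  by_contra! hcon
  have hseg : ∀ y ∈ segment ℝ x (x + h), dist x y ≤ ‖h‖ := by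
    intro y hy
    rw [segment_eq_image'] at hy
    obtain ⟨θ, hθ, rfl⟩ := hy
    rw [dist_self_add_right, add_sub_cancel_left, norm_smul, Real.norm_of_nonneg hθ.1]
    exact mul_le_of_le_one_left (norm_nonneg _) hθ.2
  have hsub : segment ℝ x (x + h) ⊆ Ω ∪ (closure Ω)ᶜ := by
    intro y hy
    by_contra hy'
    rw [Set.mem_union, not_or, Set.notMem_compl_iff] at hy'
    exact (hcon y (by rw [hΩ.frontier_eq]; exact ⟨hy'.2, hy'.1⟩)).not_ge (hseg y hy)
  have hdisj : Disjoint Ω (closure Ω)ᶜ :=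
    Set.disjoint_left.2 fun y hy hy' => hy' (subset_closure hy)
  exact hxh ((convex_segment x (x + h)).isPreconnected.subset_left_of_subset_union hΩ
    isClosed_closure.isOpen_compl hdisj hsub ⟨x, left_mem_segment ℝ _ _, hx⟩
    (right_mem_segment ℝ _ _))

/-- For a bounded Lipschitz domain, the set of points leaving `Ω` under translation by `h` has
volume `O(min(1,‖h‖))`. -/
theorem HasLipschitzBoundary.exists_volume_translate_le {n : ℕ}
    {Ω : Set (EuclideanSpace ℝ (Fin n))} (hlip : HasLipschitzBoundary Ω) (hΩ : IsOpen Ω)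
    (hb : Bornology.IsBounded Ω) :
    ∃ C : ℝ≥0∞, C ≠ ∞ ∧ ∀ h : EuclideanSpace ℝ (Fin n),
      volume {x | x ∈ Ω ∧ x + h ∉ Ω} ≤ C * ENNReal.ofReal (min 1 ‖h‖) := by
  have hcomp : IsCompact (frontier Ω) :=
    Metric.isCompact_of_isClosed_isBounded isClosed_frontier (hb.closure.subset frontier_subset_closure)
  have key : ∃ C : ℝ≥0∞, C ≠ ∞ ∧ ∃ ρ : ℝ, 0 < ρ ∧ ∀ h : EuclideanSpace ℝ (Fin n), ‖h‖ < ρ →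
      volume {x | x ∈ Ω ∧ x + h ∉ Ω ∧ ∃ z ∈ frontier Ω, dist x z ≤ ‖h‖} ≤
        C * ENNReal.ofReal ‖h‖ := by
    -- Compactness induction replaces a finite cover by charts: the bound is localized to exit
    -- points near a piece `T` of the frontier, a property inherited by subsets and finite unions.
    refine hcomp.induction_on (p := fun T => ∃ C : ℝ≥0∞, C ≠ ∞ ∧ ∃ ρ : ℝ, 0 < ρ ∧
      ∀ h : EuclideanSpace ℝ (Fin n), ‖h‖ < ρ →
        volume {x | x ∈ Ω ∧ x + h ∉ Ω ∧ ∃ z ∈ T, dist x z ≤ ‖h‖} ≤ C * ENNReal.ofReal ‖h‖) ?_ ?_ ?_ ?_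
    · exact ⟨0, by simp, 1, one_pos, by simp⟩
    · rintro S T hST ⟨C, hC, ρ, hρ, H⟩
      refine ⟨C, hC, ρ, hρ, fun h hh => (measure_mono ?_).trans (H h hh)⟩
      rintro x ⟨h1, h2, z, hz, h3⟩
      exact ⟨h1, h2, z, hST hz, h3⟩
    · rintro S T ⟨C, hC, ρ, hρ, H⟩ ⟨C', hC', ρ', hρ', H'⟩
      refine ⟨C + C', by finiteness, min ρ ρ', lt_min hρ hρ', fun h hh => ?_⟩
      rw [add_mul]
      refine le_trans (measure_mono ?_) ((measure_union_le _ _).trans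
        (add_le_add (H h (hh.trans_le (min_le_left _ _))) (H' h (hh.trans_le (min_le_right _ _)))))
      rintro x ⟨h1, h2, z, hz | hz, h3⟩
      · exact Or.inl ⟨h1, h2, z, hz, h3⟩
      · exact Or.inr ⟨h1, h2, z, hz, h3⟩
    · intro x₀ hx₀
      obtain ⟨ν, hν, g, L, hg, r, hr, hgr⟩ := hlip x₀ hx₀
      -- With `z` within `r/2` of `x₀` and `‖h‖ < r/4`, both `x` and `x + h` remain in the chart
      -- ball of radius `r`. The factor `2L + 1` is the Lipschitz constant of the height `φ` below:
      -- 1 from `⟪ν, h⟫`, and `2L` from `g`, as the projected increment has norm at most `2‖h‖`.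
      refine ⟨Metric.ball x₀ (r / 2), mem_nhdsWithin_of_mem_nhds (Metric.ball_mem_nhds _ (by linarith)),
        volume (Metric.ball x₀ (r + 1)) * ENNReal.ofReal (2 * L + 1),
        ENNReal.mul_ne_top measure_ball_lt_top.ne ENNReal.ofReal_ne_top, r / 4, by linarith, ?_⟩
      intro h hh
      rcases eq_or_ne h 0 with rfl | hh0
      · simp
      have hh1 : 0 < ‖h‖ := norm_pos_iff.2 hh0
      -- Height above the graph: in the chart `Ω = {φ > 0}`, so leaving `Ω` under `h` forces `0 < φ
      -- x ≤ (2L + 1)‖h‖`.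
      set φ : EuclideanSpace ℝ (Fin n) → ℝ := fun x => inner ℝ ν x - g (x - inner ℝ ν x • ν) with hφdef
      have hφ : Continuous φ := by
        have := hg.continuous
        fun_prop
      have hφν : ∀ x (t : ℝ), φ (x + t • ν) = φ x + t := by
        intro x t
        have h1 : inner ℝ ν (x + t • ν) = inner ℝ ν x + t := by
          rw [inner_add_right, inner_smul_right, real_inner_self_eq_norm_sq, hν]; ring
        have h2 : x + t • ν - (inner ℝ ν x + t) • ν = x - inner ℝ ν x • ν := by
          rw [add_smul]; abel
        simp only [hφdef, h1, h2]; ring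
      have hφL : ∀ x, φ x ≤ φ (x + h) + (2 * L + 1) * ‖h‖ := by
        intro x
        have h1 : |inner ℝ ν h| ≤ ‖h‖ := by
          have := abs_real_inner_le_norm ν h
          rwa [hν, one_mul] at this
        have h2 : |g (x + h - inner ℝ ν (x + h) • ν) - g (x - inner ℝ ν x • ν)| ≤ L * (2 * ‖h‖) := by
          have h3 := hg.dist_le_mul (x + h - inner ℝ ν (x + h) • ν) (x - inner ℝ ν x • ν)
          rw [Real.dist_eq] at h3
          refine h3.trans ?_
          gcongr
          have h4 : x + h - inner ℝ ν (x + h) • ν - (x - inner ℝ ν x • ν) = h - inner ℝ ν h • ν := by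
            rw [inner_add_right, add_smul]; abel
          rw [dist_eq_norm, h4]
          refine (norm_sub_le _ _).trans ?_
          rw [norm_smul, hν, mul_one, Real.norm_eq_abs]
          linarith
        have h3 := abs_le.1 h1
        have h4 := abs_le.1 h2
        simp only [hφdef]
        rw [inner_add_right] at h4 ⊢
        nlinarith [h3.1, h4.2]
      have hcoef : (0 : ℝ) < 2 * L + 1 := by positivity
      have := volume_strip_le hφ hν hφν x₀ r (ε := (2 * L + 1) * ‖h‖) (by positivity)
      rw [ENNReal.ofReal_mul hcoef.le, ← mul_assoc] at this
      refine le_trans (measure_mono ?_) this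
      rintro x ⟨hx, hxh, z, hz, hxz⟩
      rw [Metric.mem_ball] at hz
      have hxb : dist x x₀ < r := by
        have := dist_triangle x z x₀; linarith
      have hxhb : dist (x + h) x₀ < r := by
        have h1 := dist_triangle (x + h) x x₀
        have h2 := dist_triangle x z x₀
        rw [dist_self_add_left] at h1
        linarith
      have h1 := (hgr x hxb).1 hx
      have h2 : φ (x + h) ≤ 0 := sub_nonpos.2 (not_lt.1 fun h3 => hxh ((hgr _ hxhb).2 h3))
      exact ⟨hxb, sub_pos.2 h1, by linarith [hφL x]⟩
  obtain ⟨C, hC, ρ, hρ, H⟩ := key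
  -- The second summand handles `‖h‖ ≥ min 1 ρ`, where `volume Ω` is a trivial bound and `min 1 ‖h‖
  -- ≥ min 1 ρ`.
  refine ⟨C + volume Ω * ENNReal.ofReal (1 / min 1 ρ), ?_, fun h => ?_⟩
  · have := hb.measure_lt_top (μ := volume)
    finiteness
  rcases lt_or_ge ‖h‖ (min 1 ρ) with hh | hh
  · rw [min_eq_right (hh.le.trans (min_le_left _ _)), add_mul]
    refine le_trans (le_trans (measure_mono ?_) (H h (hh.trans_le (min_le_right _ _)))) le_self_add
    rintro x ⟨hx, hxh⟩
    exact ⟨hx, hxh, exists_mem_frontier_dist_le hΩ hx hxh⟩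
  · have hm : 0 < min 1 ρ := lt_min one_pos hρ
    rw [add_mul, mul_assoc, ← ENNReal.ofReal_mul (by positivity)]
    refine le_trans (le_trans (measure_mono fun x hx => hx.1) ?_) le_add_self
    refine le_mul_of_one_le_right' (ENNReal.one_le_ofReal.2 ?_)
    rw [one_div_mul_eq_div, one_le_div hm]
    exact le_min (min_le_left _ _) hh

/-! ### Cross interactions and finiteness of energies -/

/-- The integrand of the Gagliardo energy. -/
noncomputable def gagliardoIntegrand {n : ℕ} (s q : ℝ) (u : EuclideanSpace ℝ (Fin n) → ℝ)
    (z : EuclideanSpace ℝ (Fin n) × EuclideanSpace ℝ (Fin n)) : ℝ≥0∞ :=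
  ENNReal.ofReal (|u z.1 - u z.2| ^ q / ‖z.1 - z.2‖ ^ ((n : ℝ) + s * q))

theorem gagliardoIntegral_eq {n : ℕ} (Ω : Set (EuclideanSpace ℝ (Fin n))) (s q : ℝ)
    (u : EuclideanSpace ℝ (Fin n) → ℝ) :
    gagliardoIntegral Ω s q u = ∫⁻ z in Q Ω, gagliardoIntegrand s q u z := rfl

theorem aemeasurable_gagliardoIntegrand {n : ℕ} (s q : ℝ) {u : EuclideanSpace ℝ (Fin n) → ℝ}
    (hu : AEMeasurable u) : AEMeasurable (gagliardoIntegrand s q u) := by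
  have h1 : AEMeasurable (fun z : EuclideanSpace ℝ (Fin n) × EuclideanSpace ℝ (Fin n) => u z.1) :=
    hu.comp_quasiMeasurePreserving Measure.quasiMeasurePreserving_fst
  have h2 : AEMeasurable (fun z : EuclideanSpace ℝ (Fin n) × EuclideanSpace ℝ (Fin n) => u z.2) :=
    hu.comp_quasiMeasurePreserving Measure.quasiMeasurePreserving_snd
  unfold gagliardoIntegrand
  have h3 := (h1.sub h2).abs.pow_const q
  have h4 : Measurable (fun z : EuclideanSpace ℝ (Fin n) × EuclideanSpace ℝ (Fin n) =>
    ‖z.1 - z.2‖ ^ ((n : ℝ) + s * q)) := by fun_prop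
  exact (h3.div h4.aemeasurable).ennreal_ofReal

theorem measurableSet_Q {n : ℕ} {Ω : Set (EuclideanSpace ℝ (Fin n))} (hΩ : MeasurableSet Ω) :
    MeasurableSet (Q Ω) := (hΩ.compl.prod hΩ.compl).compl

theorem prod_self_subset_Q {n : ℕ} (Ω : Set (EuclideanSpace ℝ (Fin n))) : Ω ×ˢ Ω ⊆ Q Ω :=
  fun _ hz hz' => hz'.1 hz.1

/-- Tonelli in the variables `(x, y - x)`. -/
theorem lintegral_prod_translate {n : ℕ}
    {F : EuclideanSpace ℝ (Fin n) × EuclideanSpace ℝ (Fin n) → ℝ≥0∞} (hF : Measurable F) :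
    ∫⁻ z, F z = ∫⁻ h, ∫⁻ x, F (x, x + h) := by
  have hF' : Measurable fun p : EuclideanSpace ℝ (Fin n) × EuclideanSpace ℝ (Fin n) =>
    F (p.2, p.2 + p.1) := hF.comp (by fun_prop)
  rw [Measure.volume_eq_prod, lintegral_prod _ hF.aemeasurable,
    lintegral_lintegral_swap (f := fun h x => F (x, x + h)) hF'.aemeasurable]
  exact lintegral_congr fun x => (lintegral_add_left_eq_self (fun y => F (x, y)) x).symm

/-- For fixed `h = y - x` the kernel is constant in `x`, so it gets multiplied by the volume of
points leaving `Ω` under `h`. The resulting factor `min 1 ‖h‖` tames the singularity. -/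
theorem lintegral_prod_compl_lt_top {n : ℕ} {Ω : Set (EuclideanSpace ℝ (Fin n))} (hn : 0 < n)
    (hlip : HasLipschitzBoundary Ω) (hΩ : IsOpen Ω)
    (hb : Bornology.IsBounded Ω) {t : ℝ} (ht0 : 0 < t) (ht1 : t < 1) :
    ∫⁻ z in Ω ×ˢ Ωᶜ, ENNReal.ofReal (1 / ‖z.1 - z.2‖ ^ ((n : ℝ) + t)) < ∞ := by
  obtain ⟨C, hC, H⟩ := hlip.exists_volume_translate_le hΩ hb
  have hk : Measurable fun z : EuclideanSpace ℝ (Fin n) × EuclideanSpace ℝ (Fin n) =>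
    ENNReal.ofReal (1 / ‖z.1 - z.2‖ ^ ((n : ℝ) + t)) := by fun_prop
  have hS : MeasurableSet (Ω ×ˢ Ωᶜ) := hΩ.measurableSet.prod hΩ.measurableSet.compl
  rw [← lintegral_indicator hS, lintegral_prod_translate (hk.indicator hS)]
  refine lt_of_le_of_lt (lintegral_mono (g := fun h => C * ENNReal.ofReal
    (min 1 ‖h‖ / ‖h‖ ^ ((n : ℝ) + t))) fun h => ?_) ?_
  · have hmeas : MeasurableSet {x | x ∈ Ω ∧ x + h ∉ Ω} :=
      hΩ.measurableSet.inter (hΩ.measurableSet.compl.preimage (measurable_add_const h))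
    calc _ = ∫⁻ x, {x | x ∈ Ω ∧ x + h ∉ Ω}.indicator
            (fun _ => ENNReal.ofReal (1 / ‖h‖ ^ ((n : ℝ) + t))) x := by
          refine lintegral_congr fun x => ?_
          have hiff : (x, x + h) ∈ Ω ×ˢ Ωᶜ ↔ x ∈ {x | x ∈ Ω ∧ x + h ∉ Ω} := Iff.rfl
          by_cases hx : x ∈ {x | x ∈ Ω ∧ x + h ∉ Ω}
          · rw [Set.indicator_of_mem (hiff.2 hx), Set.indicator_of_mem hx, sub_add_cancel_left,
              norm_neg]
          · rw [Set.indicator_of_notMem (mt hiff.1 hx), Set.indicator_of_notMem hx]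
      _ = ENNReal.ofReal (1 / ‖h‖ ^ ((n : ℝ) + t)) * volume {x | x ∈ Ω ∧ x + h ∉ Ω} :=
          lintegral_indicator_const hmeas _
      _ ≤ ENNReal.ofReal (1 / ‖h‖ ^ ((n : ℝ) + t)) * (C * ENNReal.ofReal (min 1 ‖h‖)) := by
          gcongr; exact H h
      _ = C * ENNReal.ofReal (min 1 ‖h‖ / ‖h‖ ^ ((n : ℝ) + t)) := by
          rw [div_eq_mul_one_div (min 1 ‖h‖), ENNReal.ofReal_mul (by positivity)]; ring
  · rw [lintegral_const_mul _ (by fun_prop)]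
    exact ENNReal.mul_lt_top hC.lt_top (lintegral_min_one_norm_div_rpow_lt_top hn ht0 ht1)

theorem lintegral_Q_diff_lt_top {n : ℕ} {Ω : Set (EuclideanSpace ℝ (Fin n))} (hn : 0 < n)
    (hlip : HasLipschitzBoundary Ω) (hΩ : IsOpen Ω)
    (hb : Bornology.IsBounded Ω) {t : ℝ} (ht0 : 0 < t) (ht1 : t < 1) :
    ∫⁻ z in Q Ω \ Ω ×ˢ Ω, ENNReal.ofReal (1 / ‖z.1 - z.2‖ ^ ((n : ℝ) + t)) < ∞ := by
  have h1 := lintegral_prod_compl_lt_top hn hlip hΩ hb ht0 ht1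
  have h2 : ∫⁻ z in Ωᶜ ×ˢ Ω, ENNReal.ofReal (1 / ‖z.1 - z.2‖ ^ ((n : ℝ) + t)) < ∞ := by
    refine lt_of_eq_of_lt ?_ h1
    have := (Measure.measurePreserving_swap (μ := (volume : Measure (EuclideanSpace ℝ (Fin n))))
      (ν := (volume : Measure (EuclideanSpace ℝ (Fin n))))).setLIntegral_comp_preimage
      (hΩ.measurableSet.compl.prod hΩ.measurableSet)
      (f := fun z => ENNReal.ofReal (1 / ‖z.1 - z.2‖ ^ ((n : ℝ) + t))) (by fun_prop)
    rw [Measure.volume_eq_prod, ← this, Set.preimage_swap_prod]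
    simp only [Prod.fst_swap, Prod.snd_swap, norm_sub_rev]
  refine lt_of_le_of_lt (lintegral_mono_set ?_)
    ((lintegral_union_le _ (Ω ×ˢ Ωᶜ) (Ωᶜ ×ˢ Ω)).trans_lt (ENNReal.add_lt_top.2 ⟨h1, h2⟩))
  rintro ⟨x, y⟩ ⟨hz, hz'⟩
  simp only [Q, Set.mem_compl_iff, Set.mem_prod, Set.mem_union] at hz hz' ⊢
  tauto

/-- Puts the power of the distance coming from a Lipschitz bound into the form `min 1 ‖h‖` of the
tempered kernel. -/
theorem rpow_le_mul_min_one {r D p : ℝ} (hr : 0 ≤ r) (hrD : r ≤ D) (hp : 1 ≤ p) :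
    r ^ p ≤ (1 + D) ^ p * min 1 r := by
  rcases le_total r 1 with h | h
  · rw [min_eq_right h]
    have h1 : r ^ p ≤ r ^ (1 : ℝ) := Real.rpow_le_rpow_of_exponent_ge' hr h zero_le_one hp
    rw [Real.rpow_one] at h1
    have h2 : 1 ≤ (1 + D) ^ p := Real.one_le_rpow (by linarith) (by linarith)
    nlinarith
  · rw [min_eq_left h, mul_one]
    exact Real.rpow_le_rpow hr (by linarith) (by linarith)

theorem lintegral_prod_self_lt_top_of_lipschitzWith {n : ℕ} {Ω : Set (EuclideanSpace ℝ (Fin n))}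
    (hn : 0 < n) (hΩ : IsOpen Ω) (hb : Bornology.IsBounded Ω) {s p : ℝ} (hp : 1 ≤ p)
    (ht0 : 0 < s * p) (ht1 : s * p < 1) {f : EuclideanSpace ℝ (Fin n) → ℝ} {L : NNReal}
    (hf : LipschitzWith L f) :
    ∫⁻ z in Ω ×ˢ Ω, gagliardoIntegrand s p f z < ∞ := by
  obtain ⟨D, hD⟩ := Metric.isBounded_iff.1 hb
  have hS : MeasurableSet (Ω ×ˢ Ω) := hΩ.measurableSet.prod hΩ.measurableSet
  set c : ℝ := (L : ℝ) ^ p * (1 + |D|) ^ p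
  have hc : 0 ≤ c := by positivity
  set F : EuclideanSpace ℝ (Fin n) × EuclideanSpace ℝ (Fin n) → ℝ≥0∞ := fun z =>
    ENNReal.ofReal c * ENNReal.ofReal (min 1 ‖z.2 - z.1‖ / ‖z.2 - z.1‖ ^ ((n : ℝ) + s * p)) with hF
  have hFm : Measurable F := by fun_prop
  have hle : ∀ z ∈ Ω ×ˢ Ω, gagliardoIntegrand s p f z ≤ F z := by
    rintro ⟨x, y⟩ ⟨hx, hy⟩
    simp only [gagliardoIntegrand, hF]
    rw [← ENNReal.ofReal_mul hc, mul_div_assoc', norm_sub_rev y x]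
    refine ENNReal.ofReal_le_ofReal ?_
    gcongr
    have h1 : |f x - f y| ≤ L * ‖x - y‖ := by
      have := hf.dist_le_mul x y
      rwa [Real.dist_eq, dist_eq_norm] at this
    have h2 : ‖x - y‖ ≤ |D| := by
      have := hD hx hy
      rw [dist_eq_norm] at this
      exact this.trans (le_abs_self _)
    calc |f x - f y| ^ p ≤ (L * ‖x - y‖) ^ p := by gcongr
      _ = (L : ℝ) ^ p * ‖x - y‖ ^ p := Real.mul_rpow (by positivity) (by positivity)
      _ ≤ (L : ℝ) ^ p * ((1 + |D|) ^ p * min 1 ‖x - y‖) := by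
          gcongr; exact rpow_le_mul_min_one (norm_nonneg _) h2 hp
      _ = c * min 1 ‖x - y‖ := by ring
  refine lt_of_le_of_lt (setLIntegral_mono' hS hle) ?_
  rw [← lintegral_indicator hS, lintegral_prod_translate (hFm.indicator hS)]
  refine lt_of_le_of_lt (lintegral_mono (g := fun h => (ENNReal.ofReal c * volume Ω) *
    ENNReal.ofReal (min 1 ‖h‖ / ‖h‖ ^ ((n : ℝ) + s * p))) fun h => ?_) ?_
  · calc _ ≤ ∫⁻ x, Ω.indicator (fun _ => ENNReal.ofReal c *
              ENNReal.ofReal (min 1 ‖h‖ / ‖h‖ ^ ((n : ℝ) + s * p))) x := by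
          refine lintegral_mono fun x => ?_
          by_cases hx : x ∈ Ω
          · refine (Set.indicator_le_self _ _ _).trans ?_
            simp [hF, hx]
          · rw [Set.indicator_of_notMem fun h' => hx h'.1]; exact zero_le
      _ = _ := by rw [lintegral_indicator_const hΩ.measurableSet]; ring
  · rw [lintegral_const_mul _ (by fun_prop)]
    exact ENNReal.mul_lt_top (ENNReal.mul_lt_top ENNReal.ofReal_lt_top (hb.measure_lt_top))
      (lintegral_min_one_norm_div_rpow_lt_top hn ht0 ht1)

theorem gagliardoIntegrand_le_of_abs_le {n : ℕ} {s p M : ℝ} (hp : 0 ≤ p)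
    {v : EuclideanSpace ℝ (Fin n) → ℝ} (hv : ∀ x, |v x| ≤ M)
    (z : EuclideanSpace ℝ (Fin n) × EuclideanSpace ℝ (Fin n)) :
    gagliardoIntegrand s p v z ≤ ENNReal.ofReal ((2 * M) ^ p) *
      ENNReal.ofReal (1 / ‖z.1 - z.2‖ ^ ((n : ℝ) + s * p)) := by
  have hM : 0 ≤ M := (abs_nonneg _).trans (hv z.1)
  rw [← ENNReal.ofReal_mul (by positivity), mul_one_div]
  refine ENNReal.ofReal_le_ofReal ?_
  gcongr
  refine (abs_sub _ _).trans ?_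
  linarith [hv z.1, hv z.2]

theorem lintegral_Q_eq_add {n : ℕ} {Ω : Set (EuclideanSpace ℝ (Fin n))} (hΩ : MeasurableSet Ω)
    (F : EuclideanSpace ℝ (Fin n) × EuclideanSpace ℝ (Fin n) → ℝ≥0∞) :
    ∫⁻ z in Q Ω, F z = (∫⁻ z in Ω ×ˢ Ω, F z) + ∫⁻ z in Q Ω \ Ω ×ˢ Ω, F z := by
  rw [← lintegral_inter_add_sdiff F (Q Ω) (hΩ.prod hΩ),
    Set.inter_eq_self_of_subset_right (prod_self_subset_Q Ω)]

/-- Regularity matters only on `Ω × Ω`; for pairs with exactly one point in `Ω` boundedness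
suffices, so `v` may be rough outside `Ω`. -/
theorem gagliardoIntegral_lt_top_of_eqOn {n : ℕ} {Ω : Set (EuclideanSpace ℝ (Fin n))}
    (hn : 0 < n) (hlip : HasLipschitzBoundary Ω) (hΩ : IsOpen Ω) (hb : Bornology.IsBounded Ω)
    {s p : ℝ} (hp : 1 ≤ p)
    (ht0 : 0 < s * p) (ht1 : s * p < 1) {f v : EuclideanSpace ℝ (Fin n) → ℝ} {L : NNReal}
    (hf : LipschitzWith L f) (hfv : Set.EqOn v f Ω) {M : ℝ} (hv : ∀ x, |v x| ≤ M) :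
    gagliardoIntegral Ω s p v < ∞ := by
  rw [gagliardoIntegral_eq, lintegral_Q_eq_add hΩ.measurableSet]
  refine ENNReal.add_lt_top.2 ⟨?_, ?_⟩
  · refine lt_of_eq_of_lt (setLIntegral_congr_fun (hΩ.measurableSet.prod hΩ.measurableSet) ?_)
      (lintegral_prod_self_lt_top_of_lipschitzWith hn hΩ hb hp ht0 ht1 hf)
    rintro ⟨x, y⟩ ⟨hx, hy⟩
    simp only [gagliardoIntegrand, hfv hx, hfv hy]
  · refine lt_of_le_of_lt (lintegral_mono (gagliardoIntegrand_le_of_abs_le (by linarith) hv)) ?_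
    rw [lintegral_const_mul _ (by fun_prop)]
    exact ENNReal.mul_lt_top ENNReal.ofReal_lt_top (lintegral_Q_diff_lt_top hn hlip hΩ hb ht0 ht1)

/-! ### The liminf inequality -/

/-- The `(s,q)`-energy of `u` on a set `S ⊆ ℝ²ⁿ` of pairs. -/
noncomputable def energyOn {n : ℕ} (S : Set (EuclideanSpace ℝ (Fin n) × EuclideanSpace ℝ (Fin n)))
    (s q : ℝ) (u : EuclideanSpace ℝ (Fin n) → ℝ) : ℝ≥0∞ :=
  ENNReal.ofReal (1 / (2 * q)) * ∫⁻ z in S, gagliardoIntegrand s q u z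

/-- The prefactor is positive, so it sends `∞` to `∞` and the case distinction is redundant. -/
theorem extEnergy_eq_energyOn {n : ℕ} (Ω : Set (EuclideanSpace ℝ (Fin n))) (s : ℝ) {q : ℝ}
    (hq : 0 < q) (u : L1Loc n) : extEnergy Ω s q u = energyOn (Q Ω) s q u.toFun := by
  unfold extEnergy energyOn
  rw [← gagliardoIntegral_eq]
  split_ifs with h
  · rfl
  · have h' : gagliardoIntegral Ω s q u.toFun = ∞ := not_lt_top_iff.1 h
    rw [h', ENNReal.mul_top]
    simpa using hq

theorem tendsto_gagliardoIntegrand {n : ℕ} {ι : Type*} {l : Filter ι} {s : ℝ} {p : ι → ℝ}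
    (hp : Tendsto p l (𝓝 1)) {u : ι → EuclideanSpace ℝ (Fin n) → ℝ}
    {v : EuclideanSpace ℝ (Fin n) → ℝ} {z : EuclideanSpace ℝ (Fin n) × EuclideanSpace ℝ (Fin n)}
    (h1 : Tendsto (fun k => u k z.1) l (𝓝 (v z.1)))
    (h2 : Tendsto (fun k => u k z.2) l (𝓝 (v z.2))) :
    Tendsto (fun k => gagliardoIntegrand s (p k) (u k) z) l (𝓝 (gagliardoIntegrand s 1 v z)) := by
  unfold gagliardoIntegrand
  refine ENNReal.tendsto_ofReal ?_
  rcases eq_or_ne z.1 z.2 with hz | hz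
  -- On the diagonal the integrand is zero only for nonzero exponents, since `0 ^ 0 = 1`; this holds
  -- eventually as `p k → 1`.
  · simp only [hz, sub_self, abs_zero]
    refine tendsto_const_nhds.congr' ?_
    filter_upwards [hp.eventually_ne one_ne_zero] with k hk
    rw [Real.zero_rpow hk, Real.zero_rpow one_ne_zero, zero_div, zero_div]
  · have hz' : 0 < ‖z.1 - z.2‖ := norm_pos_iff.2 (sub_ne_zero.2 hz)
    refine Tendsto.div ?_ ?_ (Real.rpow_pos_of_pos hz' _).ne'
    · exact (h1.sub h2).abs.rpow hp (Or.inr one_pos)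
    · exact tendsto_const_nhds.rpow (tendsto_const_nhds.add (tendsto_const_nhds.mul hp))
        (Or.inl hz'.ne')

theorem tendsto_ofReal_one_div_two_mul {ι : Type*} {l : Filter ι} {p : ι → ℝ}
    (hp : Tendsto p l (𝓝 1)) :
    Tendsto (fun k => ENNReal.ofReal (1 / (2 * p k))) l (𝓝 (ENNReal.ofReal (1 / (2 * 1)))) :=
  ENNReal.tendsto_ofReal (tendsto_const_nhds.div (tendsto_const_nhds.mul hp) (by norm_num))

theorem energyOn_le_liminf_of_ae {n : ℕ}
    {S : Set (EuclideanSpace ℝ (Fin n) × EuclideanSpace ℝ (Fin n))} {s : ℝ} {p : ℕ → ℝ}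
    (hp : Tendsto p atTop (𝓝 1)) {u : ℕ → EuclideanSpace ℝ (Fin n) → ℝ}
    {v : EuclideanSpace ℝ (Fin n) → ℝ} (hu : ∀ k, AEMeasurable (u k))
    (h : ∀ᵐ z ∂(volume.restrict S), Tendsto (fun k => u k z.1) atTop (𝓝 (v z.1)) ∧
      Tendsto (fun k => u k z.2) atTop (𝓝 (v z.2))) :
    energyOn S s 1 v ≤ liminf (fun k => energyOn S s (p k) (u k)) atTop := by
  have hm : ∀ k, AEMeasurable (gagliardoIntegrand s (p k) (u k)) (volume.restrict S) :=
    fun k => (aemeasurable_gagliardoIntegrand s (p k) (hu k)).restrict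
  have e : ∀ k, energyOn S s (p k) (u k) = ∫⁻ z in S, ENNReal.ofReal (1 / (2 * p k)) *
      gagliardoIntegrand s (p k) (u k) z := fun k => (lintegral_const_mul'' _ (hm k)).symm
  simp only [e]
  refine le_trans ?_ (lintegral_liminf_le' fun k => (hm k).const_mul _)
  rw [energyOn, ← lintegral_const_mul' _ _ ENNReal.ofReal_ne_top]
  refine lintegral_mono_ae ?_
  filter_upwards [h] with z hz
  exact (ENNReal.Tendsto.mul (tendsto_ofReal_one_div_two_mul hp) (Or.inr ENNReal.ofReal_ne_top)
    (tendsto_gagliardoIntegrand hp hz.1 hz.2) (Or.inr ENNReal.ofReal_ne_top)).liminf_eq.ge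

theorem ae_restrict_prod_of_ae_restrict {α : Type*} [MeasureSpace α]
    [SFinite (volume : Measure α)] {B : Set α} {P : α → Prop}
    (h : ∀ᵐ x ∂(volume.restrict B), P x) :
    ∀ᵐ z ∂((volume : Measure (α × α)).restrict (B ×ˢ B)), P z.1 ∧ P z.2 := by
  rw [Measure.volume_eq_prod, ← Measure.prod_restrict]
  exact (Measure.quasiMeasurePreserving_fst.ae h).and (Measure.quasiMeasurePreserving_snd.ae h)

theorem energyOn_mono {n : ℕ} {S T : Set (EuclideanSpace ℝ (Fin n) × EuclideanSpace ℝ (Fin n))}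
    (hST : S ⊆ T) (s q : ℝ) (u : EuclideanSpace ℝ (Fin n) → ℝ) :
    energyOn S s q u ≤ energyOn T s q u := by
  unfold energyOn
  gcongr

theorem L1Loc.aemeasurable {n : ℕ} (u : L1Loc n) : AEMeasurable u.toFun :=
  u.locallyIntegrable.aestronglyMeasurable.aemeasurable

/-- If the inequality failed, some subsequence would have energies below a constant `c` smaller than
the left side. Convergence in `L¹` of the ball gives a further subsequence converging a.e. there,
and Fatou contradicts the choice of `c`. -/
theorem energyOn_inter_closedBall_le_liminf {n : ℕ}
    (S : Set (EuclideanSpace ℝ (Fin n) × EuclideanSpace ℝ (Fin n))) {s : ℝ} {p : ℕ → ℝ}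
    (hp : Tendsto p atTop (𝓝 1)) {u : ℕ → L1Loc n} {v : L1Loc n} (hu : Tendsto u atTop (𝓝 v))
    (R : ℝ) :
    energyOn (S ∩ Metric.closedBall 0 R ×ˢ Metric.closedBall 0 R) s 1 v.toFun ≤
      liminf (fun k => energyOn S s (p k) (u k).toFun) atTop := by
  by_contra! hlt
  obtain ⟨c, hc1, hc2⟩ := exists_between hlt
  obtain ⟨φ, hφ, hφc⟩ := extraction_of_frequently_atTop (frequently_lt_of_liminf_lt (h := hc1))
  have hconv : TendstoInMeasure (volume.restrict (Metric.closedBall 0 R))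
      (fun k => (u (φ k)).toFun) atTop v.toFun := by
    refine tendstoInMeasure_of_tendsto_eLpNorm one_ne_zero
      (fun k => (u (φ k)).aemeasurable.aestronglyMeasurable.restrict)
      v.aemeasurable.aestronglyMeasurable.restrict ?_
    simp only [eLpNorm_one_eq_lintegral_enorm]
    exact (L1Loc.tendsto_iff.1 hu _ (isCompact_closedBall 0 R)).comp hφ.tendsto_atTop
  obtain ⟨ψ, hψ, hae⟩ := hconv.exists_seq_tendsto_ae
  have hae2 := ae_mono (Measure.restrict_mono_set _ (Set.inter_subset_right (s := S)))
    (ae_restrict_prod_of_ae_restrict hae)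
  have hF := energyOn_le_liminf_of_ae (s := s)
    (hp.comp (hφ.comp hψ).tendsto_atTop) (u := fun k => (u (φ (ψ k))).toFun)
    (fun k => (u (φ (ψ k))).aemeasurable) hae2
  refine (hF.trans ?_).not_gt hc2
  refine liminf_le_of_frequently_le' (Eventually.frequently (Eventually.of_forall fun k => ?_))
  exact (energyOn_mono Set.inter_subset_left _ _ _).trans (hφc (ψ k)).le

/-- The liminf inequality: `L¹_loc`-lower semicontinuity of the energies as `p → 1`. -/
theorem energyOn_le_liminf {n : ℕ}
    (S : Set (EuclideanSpace ℝ (Fin n) × EuclideanSpace ℝ (Fin n))) {s : ℝ} {p : ℕ → ℝ}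
    (hp : Tendsto p atTop (𝓝 1)) {u : ℕ → L1Loc n} {v : L1Loc n} (hu : Tendsto u atTop (𝓝 v)) :
    energyOn S s 1 v.toFun ≤ liminf (fun k => energyOn S s (p k) (u k).toFun) atTop := by
  set B : ℕ → Set (EuclideanSpace ℝ (Fin n) × EuclideanSpace ℝ (Fin n)) := fun m =>
    S ∩ Metric.closedBall 0 m ×ˢ Metric.closedBall 0 m with hB
  have hBmono : Monotone B := fun i j hij => by
    have : (i : ℝ) ≤ j := by exact_mod_cast hij
    simp only [hB]
    gcongr
  have hBU : ⋃ m, B m = S := by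
    refine Set.Subset.antisymm (Set.iUnion_subset fun m => Set.inter_subset_left) fun z hz => ?_
    obtain ⟨m, hm⟩ := exists_nat_ge ‖z‖
    refine Set.mem_iUnion.2 ⟨m, hz, ?_, ?_⟩
    · rw [mem_closedBall_zero_iff]; exact (norm_fst_le z).trans hm
    · rw [mem_closedBall_zero_iff]; exact (norm_snd_le z).trans hm
  have : energyOn S s 1 v.toFun = ⨆ m, energyOn (B m) s 1 v.toFun := by
    unfold energyOn
    rw [← ENNReal.mul_iSup, ← setLIntegral_iUnion_of_directed _ hBmono.directed_le, hBU]
  rw [this]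
  exact iSup_le fun m => energyOn_inter_closedBall_le_liminf S hp hu m

/-! ### Mollification of bounded functions inside Ω -/

theorem gagliardoIntegrand_one_eq {n : ℕ} (s : ℝ) (u : EuclideanSpace ℝ (Fin n) → ℝ)
    (z : EuclideanSpace ℝ (Fin n) × EuclideanSpace ℝ (Fin n)) :
    gagliardoIntegrand s 1 u z =
      ENNReal.ofReal (1 / ‖z.1 - z.2‖ ^ ((n : ℝ) + s)) * ‖u z.1 - u z.2‖ₑ := by
  unfold gagliardoIntegrand
  rw [← ofReal_norm, ← ENNReal.ofReal_mul (by positivity), Real.rpow_one, mul_one,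
    Real.norm_eq_abs, one_div_mul_eq_div]

open scoped Convolution in
/-- The `(s,1)`-seminorm on `ℝⁿ` does not increase under convolution with a normed bump. -/
theorem lintegral_gagliardoIntegrand_convolution_le {n : ℕ} (s : ℝ)
    (φ : ContDiffBump (0 : EuclideanSpace ℝ (Fin n))) {f : EuclideanSpace ℝ (Fin n) → ℝ}
    (hf : Measurable f) {M : ℝ} (hM : ∀ x, |f x| ≤ M) :
    ∫⁻ z, gagliardoIntegrand s 1 (φ.normed volume ⋆[ContinuousLinearMap.lsmul ℝ ℝ, volume] f) z ≤
      ∫⁻ z, gagliardoIntegrand s 1 f z := by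
  have hφ := φ.integrable_normed (μ := (volume : Measure (EuclideanSpace ℝ (Fin n))))
  have hint : ∀ x, Integrable (fun t => φ.normed volume t * f (x - t)) volume := fun x =>
    hφ.mul_bdd (hf.comp (measurable_const.sub measurable_id)).aestronglyMeasurable
      (ae_of_all _ fun t => hM _)
  have hw : ∫⁻ t, ENNReal.ofReal (φ.normed volume t) = 1 := by
    rw [← ofReal_integral_eq_lintegral_ofReal hφ (ae_of_all _ φ.nonneg_normed), φ.integral_normed,
      ENNReal.ofReal_one]
  have hφm : Measurable (φ.normed (volume : Measure (EuclideanSpace ℝ (Fin n)))) :=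
    φ.continuous_normed.measurable
  have hG : Measurable (gagliardoIntegrand (n := n) s 1 f) := by
    simp only [funext (gagliardoIntegrand_one_eq s f)]
    fun_prop
  calc _ ≤ ∫⁻ z : EuclideanSpace ℝ (Fin n) × EuclideanSpace ℝ (Fin n), ∫⁻ t, ENNReal.ofReal (φ.normed volume t) *
        gagliardoIntegrand s 1 f (z.1 - t, z.2 - t) := by
        refine lintegral_mono fun z => ?_
        simp only [gagliardoIntegrand_one_eq, convolution_def, ContinuousLinearMap.lsmul_apply,
          smul_eq_mul, sub_sub_sub_cancel_right]
        rw [← integral_sub (hint _) (hint _)]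
        refine (mul_le_mul_right (enorm_integral_le_lintegral_enorm _) _).trans ?_
        rw [← lintegral_const_mul' _ _ ENNReal.ofReal_ne_top]
        refine lintegral_mono fun t => le_of_eq ?_
        simp only
        rw [← mul_sub, enorm_mul, Real.enorm_of_nonneg (φ.nonneg_normed t)]
        ring
    _ = ∫⁻ t, ∫⁻ z : EuclideanSpace ℝ (Fin n) × EuclideanSpace ℝ (Fin n),
        ENNReal.ofReal (φ.normed volume t) *
        gagliardoIntegrand s 1 f (z.1 - t, z.2 - t) := by
        refine lintegral_lintegral_swap (f := fun (z : EuclideanSpace ℝ (Fin n) ×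
          EuclideanSpace ℝ (Fin n)) t => ENNReal.ofReal (φ.normed volume t) *
          gagliardoIntegrand s 1 f (z.1 - t, z.2 - t)) (Measurable.aemeasurable ?_)
        refine (hφm.comp measurable_snd).ennreal_ofReal.mul (hG.comp ?_)
        fun_prop
    _ = ∫⁻ t, ENNReal.ofReal (φ.normed volume t) * ∫⁻ z, gagliardoIntegrand s 1 f z := by
        refine lintegral_congr fun t => ?_
        rw [lintegral_const_mul' _ _ ENNReal.ofReal_ne_top]
        congr 1
        rw [Measure.volume_eq_prod]
        -- The kernel depends only on `x - y`, so moving both points by `t` is a translation of ℝ²ⁿ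
        -- by `(t, t)`.
        exact lintegral_sub_right_eq_self (gagliardoIntegrand s 1 f) (t, t)
    _ = _ := by rw [lintegral_mul_const _ hφm.ennreal_ofReal, hw, one_mul]

open scoped Convolution in
/-- Mollification of a bounded compactly supported function. -/
theorem exists_lipschitz_approximation {n : ℕ} (s : ℝ) {f : EuclideanSpace ℝ (Fin n) → ℝ}
    (hf : Measurable f) (hfc : HasCompactSupport f) {M : ℝ} (hM : ∀ x, |f x| ≤ M) :
    ∃ F : ℕ → EuclideanSpace ℝ (Fin n) → ℝ, (∀ j, ∃ L, LipschitzWith L (F j)) ∧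
      (∀ j x, |F j x| ≤ M) ∧ (∀ᵐ x, Tendsto (fun j => F j x) atTop (𝓝 (f x))) ∧
      ∀ j, ∫⁻ z, gagliardoIntegrand s 1 (F j) z ≤ ∫⁻ z, gagliardoIntegrand s 1 f z := by
  have hfl : LocallyIntegrable f volume := by
    refine (locallyIntegrable_const M).mono hf.aestronglyMeasurable (ae_of_all _ fun x => ?_)
    exact (hM x).trans (le_abs_self M)
  -- The outer radius is twice the inner one: a bounded ratio is what a.e. convergence at Lebesgue
  -- points requires.
  let φ : ℕ → ContDiffBump (0 : EuclideanSpace ℝ (Fin n)) := fun j =>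
    ⟨1 / ((j : ℝ) + 1), 2 * (1 / ((j : ℝ) + 1)), by positivity, by
      have : 0 < 1 / ((j : ℝ) + 1) := by positivity
      linarith⟩
  refine ⟨fun j => (φ j).normed volume ⋆[ContinuousLinearMap.lsmul ℝ ℝ, volume] f, fun j => ?_,
    fun j x => ?_, ?_, fun j => lintegral_gagliardoIntegrand_convolution_le s (φ j) hf hM⟩
  · have h1 : HasCompactSupport ((φ j).normed volume ⋆[ContinuousLinearMap.lsmul ℝ ℝ, volume] f) :=
      (φ j).hasCompactSupport_normed.convolution _ hfc
    have h2 : ContDiff ℝ 1 ((φ j).normed volume ⋆[ContinuousLinearMap.lsmul ℝ ℝ, volume] f) :=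
      (φ j).hasCompactSupport_normed.contDiff_convolution_left _ (φ j).contDiff_normed hfl
    exact h2.lipschitzWith_of_hasCompactSupport h1 one_ne_zero
  · have h := norm_integral_le_of_norm_le
      (f := fun t => (φ j).normed volume t * f (x - t)) (g := fun t => (φ j).normed volume t * M)
      ((φ j).integrable_normed.mul_const M) (ae_of_all _ fun t => ?_)
    · rw [integral_mul_const, (φ j).integral_normed, one_mul] at h
      exact h
    · rw [norm_mul, Real.norm_of_nonneg ((φ j).nonneg_normed t)]
      exact mul_le_mul_of_nonneg_left (hM _) ((φ j).nonneg_normed t)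
  · refine ContDiffBump.ae_convolution_tendsto_right_of_locallyIntegrable (K := 2) ?_ ?_ hfl
    · have := (tendsto_one_div_add_atTop_nhds_zero_nat (𝕜 := ℝ)).const_mul 2
      rwa [mul_zero] at this
    · exact Eventually.of_forall fun j => le_rfl

/-- If the total of two parts does not exceed that of the limit and one part is lower
semicontinuous, the other part is almost bounded by its limit. Finiteness of `a` allows
cancellation. -/
theorem eventually_le_add_of_add_le {x y : ℕ → ℝ≥0∞} {a b ε : ℝ≥0∞} (ha : a ≠ ∞)
    (hε : ε ≠ 0) (hxy : ∀ j, y j + x j ≤ b + a) (hx : a ≤ liminf x atTop) :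
    ∀ᶠ j in atTop, y j ≤ b + ε := by
  have h : ∀ᶠ j in atTop, a ≤ x j + ε := by
    rcases eq_or_ne a 0 with rfl | h0
    · exact Eventually.of_forall fun _ => zero_le
    · filter_upwards [eventually_lt_of_lt_liminf ((ENNReal.sub_lt_self ha h0 hε).trans_le hx)]
        with j hj
      exact tsub_le_iff_right.1 hj.le
  filter_upwards [h] with j hj
  refine ENNReal.le_of_add_le_add_right ha ?_
  calc y j + a ≤ y j + (x j + ε) := by gcongr
    _ = y j + x j + ε := by ring
    _ ≤ b + a + ε := add_le_add_left (hxy j) ε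
    _ = b + ε + a := by ring

theorem eventually_le_add_of_tendsto {x : ℕ → ℝ≥0∞} {a ε : ℝ≥0∞} (h : Tendsto x atTop (𝓝 a))
    (ha : a ≠ ∞) (hε : ε ≠ 0) : ∀ᶠ j in atTop, x j ≤ a + ε :=
  (h.eventually_lt_const (ENNReal.lt_add_right ha hε)).mono fun _ h => h.le

theorem tendsto_gagliardoIntegrand_one {n : ℕ} (s : ℝ) {u : ℕ → EuclideanSpace ℝ (Fin n) → ℝ}
    {v : EuclideanSpace ℝ (Fin n) → ℝ} (h : ∀ᵐ x, Tendsto (fun k => u k x) atTop (𝓝 (v x))) :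
    ∀ᵐ z, Tendsto (fun k => gagliardoIntegrand s 1 (u k) z) atTop
      (𝓝 (gagliardoIntegrand s 1 v z)) := by
  rw [Measure.volume_eq_prod]
  filter_upwards [Measure.quasiMeasurePreserving_fst.ae h, Measure.quasiMeasurePreserving_snd.ae h]
    with z h1 h2
  exact tendsto_gagliardoIntegrand tendsto_const_nhds h1 h2

theorem locallyIntegrable_of_abs_le {n : ℕ} {v : EuclideanSpace ℝ (Fin n) → ℝ}
    (hv : Measurable v) {M : ℝ} (hM : ∀ x, |v x| ≤ M) : LocallyIntegrable v volume :=
  (locallyIntegrable_const M).mono hv.aestronglyMeasurable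
    (ae_of_all _ fun x => (hM x).trans (le_abs_self M))

/-- Pairs inside `Ω` are controlled by the energy of `u`, pairs across the boundary by `M` and the
integrable kernel, and pairs outside contribute nothing. -/
theorem lintegral_gagliardoIntegrand_indicator_lt_top {n : ℕ}
    {Ω : Set (EuclideanSpace ℝ (Fin n))} (hn : 0 < n) (hlip : HasLipschitzBoundary Ω)
    (hΩ : IsOpen Ω) (hb : Bornology.IsBounded Ω) {s : ℝ} (hs0 : 0 < s) (hs1 : s < 1)
    {u : EuclideanSpace ℝ (Fin n) → ℝ} {M : ℝ} (hM : ∀ x, |u x| ≤ M)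
    (hfin : gagliardoIntegral Ω s 1 u < ∞) :
    ∫⁻ z, gagliardoIntegrand s 1 (Ω.indicator u) z < ∞ := by
  have hM0 : ∀ x, |Ω.indicator u x| ≤ M := fun x => by
    by_cases hx : x ∈ Ω
    · rw [Set.indicator_of_mem hx]; exact hM x
    · rw [Set.indicator_of_notMem hx, abs_zero]; exact (abs_nonneg _).trans (hM x)
  have hQ := measurableSet_Q hΩ.measurableSet
  rw [← lintegral_add_compl _ hQ, lintegral_Q_eq_add hΩ.measurableSet]
  refine ENNReal.add_lt_top.2 ⟨ENNReal.add_lt_top.2 ⟨?_, ?_⟩, ?_⟩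
  · refine lt_of_le_of_lt ?_ hfin
    rw [gagliardoIntegral_eq]
    refine le_trans (le_of_eq (setLIntegral_congr_fun (hΩ.measurableSet.prod hΩ.measurableSet) ?_))
      (lintegral_mono_set (prod_self_subset_Q Ω))
    rintro z ⟨h1, h2⟩
    simp only [gagliardoIntegrand, Set.indicator_of_mem h1, Set.indicator_of_mem h2]
  · refine lt_of_le_of_lt (lintegral_mono (gagliardoIntegrand_le_of_abs_le zero_le_one hM0)) ?_
    rw [lintegral_const_mul _ (by fun_prop), mul_one]
    exact ENNReal.mul_lt_top ENNReal.ofReal_lt_top (lintegral_Q_diff_lt_top hn hlip hΩ hb hs0 hs1)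
  · refine lt_of_eq_of_lt (setLIntegral_congr_fun (g := fun _ => 0) hQ.compl ?_) (by simp)
    intro z hz
    have hz' : z ∈ Ωᶜ ×ˢ Ωᶜ := not_not.1 hz
    simp [gagliardoIntegrand_one_eq, Set.indicator_of_notMem hz'.1, Set.indicator_of_notMem hz'.2]

/-- A bounded function of finite `(s,1)`-energy is approximated, in norm and in energy, by functions
of finite `(s,p)`-energy for some `p > 1`. -/
theorem exists_approximation_of_abs_le {n : ℕ} {Ω : Set (EuclideanSpace ℝ (Fin n))} (hn : 0 < n)
    (hlip : HasLipschitzBoundary Ω) (hΩ : IsOpen Ω) (hb : Bornology.IsBounded Ω) {s : ℝ}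
    (hs0 : 0 < s) (hs1 : s < 1) {u : EuclideanSpace ℝ (Fin n) → ℝ} (hu : Measurable u) {M : ℝ}
    (hM : ∀ x, |u x| ≤ M) (hfin : gagliardoIntegral Ω s 1 u < ∞) {ε : ℝ≥0∞} (hε : ε ≠ 0) :
    ∃ v : L1Loc n, ∫⁻ x, ‖v.toFun x - u x‖ₑ ≤ ε ∧
      gagliardoIntegral Ω s 1 v.toFun ≤ gagliardoIntegral Ω s 1 u + ε ∧
      ∃ p > 1, gagliardoIntegral Ω s p v.toFun < ∞ := by
  classical
  have hΩm := hΩ.measurableSet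
  have hΩΩ : MeasurableSet (Ω ×ˢ Ω) := hΩm.prod hΩm
  set f := Ω.indicator u with hfdef
  have hf : Measurable f := hu.indicator hΩm
  have hfM : ∀ x, |f x| ≤ M := fun x => by
    by_cases hx : x ∈ Ω
    · rw [hfdef, Set.indicator_of_mem hx]; exact hM x
    · rw [hfdef, Set.indicator_of_notMem hx, abs_zero]; exact (abs_nonneg _).trans (hM x)
  have hfc : HasCompactSupport f := HasCompactSupport.of_support_subset_isCompact
    hb.isCompact_closure (Set.support_indicator_subset.trans subset_closure)
  obtain ⟨F, hFL, hFM, hFae, hFe⟩ := exists_lipschitz_approximation s hf hfc hfM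
  have hFm : ∀ j, Measurable (F j) := fun j => (hFL j).choose_spec.continuous.measurable
  -- Mollified inside `Ω`, untouched outside: `Q Ω` contains no pair with both points outside, so no
  -- smoothness is needed there.
  set v : ℕ → EuclideanSpace ℝ (Fin n) → ℝ := fun j => Ω.piecewise (F j) u with hvdef
  have hvm : ∀ j, Measurable (v j) := fun j => (hFm j).piecewise hΩm hu
  have hvM : ∀ j x, |v j x| ≤ M := fun j x => by
    by_cases hx : x ∈ Ω
    · simp only [hvdef, Set.piecewise_eq_of_mem _ _ _ hx]; exact hFM j x
    · simp only [hvdef, Set.piecewise_eq_of_notMem _ _ _ hx]; exact hM x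
  have hvF : ∀ j, Set.EqOn (v j) (F j) Ω := fun j x hx => Set.piecewise_eq_of_mem _ _ _ hx
  have hvae : ∀ᵐ x, Tendsto (fun j => v j x) atTop (𝓝 (u x)) := by
    filter_upwards [hFae] with x hx
    by_cases hxΩ : x ∈ Ω
    · simpa only [hvdef, Set.piecewise_eq_of_mem _ _ _ hxΩ, hfdef, Set.indicator_of_mem hxΩ] using hx
    · simp only [hvdef, Set.piecewise_eq_of_notMem _ _ _ hxΩ]; exact tendsto_const_nhds
  have hL1 : Tendsto (fun j => ∫⁻ x, ‖v j x - u x‖ₑ) atTop (𝓝 (∫⁻ _x : EuclideanSpace ℝ (Fin n), 0)) := by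
    refine tendsto_lintegral_filter_of_dominated_convergence'
      (Ω.indicator fun _ => ENNReal.ofReal (2 * M))
      (Eventually.of_forall fun j => ((hvm j).sub hu).enorm.aemeasurable)
      (Eventually.of_forall fun j => ae_of_all _ fun x => ?_) ?_ ?_
    · by_cases hx : x ∈ Ω
      · rw [Set.indicator_of_mem hx, ← ofReal_norm]
        refine ENNReal.ofReal_le_ofReal ((norm_sub_le _ _).trans ?_)
        simp only [Real.norm_eq_abs]
        linarith [hvM j x, hM x]
      · simp [hvdef, Set.piecewise_eq_of_notMem _ _ _ hx]
    · rw [lintegral_indicator_const hΩm]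
      exact ENNReal.mul_ne_top ENNReal.ofReal_ne_top hb.measure_lt_top.ne
    · filter_upwards [hvae] with x hx
      have := (hx.sub_const (u x)).enorm
      simpa using this
  rw [lintegral_zero] at hL1
  have htot := lintegral_gagliardoIntegrand_indicator_lt_top hn hlip hΩ hb hs0 hs1 hM hfin
  have hε2 : ε / 2 ≠ 0 := (ENNReal.half_pos hε).ne'
  -- Upper bound on `Ω × Ω` from the nonincreasing total over ℝ²ⁿ and Fatou on the complement.
  have hin : ∀ᶠ j in atTop, ∫⁻ z in Ω ×ˢ Ω, gagliardoIntegrand s 1 (F j) z ≤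
      (∫⁻ z in Ω ×ˢ Ω, gagliardoIntegrand s 1 f z) + ε / 2 := by
    refine eventually_le_add_of_add_le
      (x := fun j => ∫⁻ z in (Ω ×ˢ Ω)ᶜ, gagliardoIntegrand s 1 (F j) z)
      (a := ∫⁻ z in (Ω ×ˢ Ω)ᶜ, gagliardoIntegrand s 1 f z)
      ((setLIntegral_le_lintegral _ _).trans_lt htot).ne hε2 (fun j => ?_) ?_
    · rw [lintegral_add_compl _ hΩΩ, lintegral_add_compl _ hΩΩ]
      exact hFe j
    · refine le_trans (lintegral_mono_ae ?_) (lintegral_liminf_le' fun j =>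
        (aemeasurable_gagliardoIntegrand s 1 (hFm j).aemeasurable).restrict)
      filter_upwards [ae_restrict_of_ae (tendsto_gagliardoIntegrand_one s hFae)] with z hz
      exact hz.liminf_eq.ge
  have hout : Tendsto (fun j => ∫⁻ z in Q Ω \ Ω ×ˢ Ω, gagliardoIntegrand s 1 (v j) z) atTop
      (𝓝 (∫⁻ z in Q Ω \ Ω ×ˢ Ω, gagliardoIntegrand s 1 u z)) := by
    refine tendsto_lintegral_filter_of_dominated_convergence' (fun z =>
      ENNReal.ofReal ((2 * M) ^ (1 : ℝ)) * ENNReal.ofReal (1 / ‖z.1 - z.2‖ ^ ((n : ℝ) + s * 1)))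
      (Eventually.of_forall fun j =>
        (aemeasurable_gagliardoIntegrand s 1 (hvm j).aemeasurable).restrict)
      (Eventually.of_forall fun j => ae_of_all _
        (gagliardoIntegrand_le_of_abs_le zero_le_one (hvM j))) ?_
      (ae_restrict_of_ae (tendsto_gagliardoIntegrand_one s hvae))
    rw [lintegral_const_mul _ (by fun_prop), mul_one]
    exact ENNReal.mul_ne_top ENNReal.ofReal_ne_top
      (lintegral_Q_diff_lt_top hn hlip hΩ hb hs0 hs1).ne
  have hcross : ∫⁻ z in Q Ω \ Ω ×ˢ Ω, gagliardoIntegrand s 1 u z ≠ ∞ :=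
    ((lintegral_mono_set Set.sdiff_subset).trans_lt hfin).ne
  obtain ⟨j, hj1, hj2, hj3⟩ := ((eventually_le_add_of_tendsto hL1 ENNReal.zero_ne_top hε).and
    (hin.and (eventually_le_add_of_tendsto hout hcross hε2))).exists
  rw [zero_add] at hj1
  -- The exponent is the midpoint of 1 and `1/s`, so that `s p = (s + 1)/2 < 1`.
  refine ⟨⟨v j, locallyIntegrable_of_abs_le (hvm j) (hvM j)⟩, hj1, ?_, (1 + 1 / s) / 2, ?_, ?_⟩
  · simp only [gagliardoIntegral_eq]
    rw [lintegral_Q_eq_add hΩm, lintegral_Q_eq_add hΩm]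
    have e1 : ∫⁻ z in Ω ×ˢ Ω, gagliardoIntegrand s 1 (v j) z =
        ∫⁻ z in Ω ×ˢ Ω, gagliardoIntegrand s 1 (F j) z := by
      refine setLIntegral_congr_fun hΩΩ fun z hz => ?_
      simp only [gagliardoIntegrand, hvF j hz.1, hvF j hz.2]
    have e2 : ∫⁻ z in Ω ×ˢ Ω, gagliardoIntegrand s 1 f z =
        ∫⁻ z in Ω ×ˢ Ω, gagliardoIntegrand s 1 u z := by
      refine setLIntegral_congr_fun hΩΩ fun z hz => ?_
      simp only [gagliardoIntegrand, hfdef, Set.indicator_of_mem hz.1, Set.indicator_of_mem hz.2]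
    rw [e1, ← e2]
    refine (add_le_add hj2 hj3).trans (le_of_eq ?_)
    rw [add_add_add_comm, ENNReal.add_halves]
  · have := (one_lt_div hs0).2 hs1
    linarith
  · have hsp : s * ((1 + 1 / s) / 2) = (s + 1) / 2 := by field_simp
    obtain ⟨L, hL⟩ := hFL j
    refine gagliardoIntegral_lt_top_of_eqOn hn hlip hΩ hb ?_ ?_ ?_ hL (hvF j) (hvM j)
    · have := (one_lt_div hs0).2 hs1
      linarith
    · rw [hsp]; linarith
    · rw [hsp]; linarith

/-! ### Varying the exponent, and diagonal selection -/

/-- Off the diagonal the integrand is `t^r / |x - y|^n` with `t = |u x - u y| / |x - y|^s`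
independent of `r`, and `t^p ≤ t + t^q`. This is the dominating function for exponents in `[1, q]`.
-/
theorem gagliardoIntegrand_le_add {n : ℕ} {s p q : ℝ} (hs0 : 0 < s) (hp1 : 1 ≤ p) (hpq : p ≤ q)
    (u : EuclideanSpace ℝ (Fin n) → ℝ)
    (z : EuclideanSpace ℝ (Fin n) × EuclideanSpace ℝ (Fin n)) :
    gagliardoIntegrand s p u z ≤ gagliardoIntegrand s 1 u z + gagliardoIntegrand s q u z := by
  unfold gagliardoIntegrand
  rw [← ENNReal.ofReal_add (by positivity) (by positivity)]
  refine ENNReal.ofReal_le_ofReal ?_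
  rcases (norm_nonneg (z.1 - z.2)).eq_or_lt with h | h
  · rw [← h, Real.zero_rpow (by positivity), div_zero]
    positivity
  · have key : ∀ r : ℝ, |u z.1 - u z.2| ^ r / ‖z.1 - z.2‖ ^ ((n : ℝ) + s * r) =
        (|u z.1 - u z.2| / ‖z.1 - z.2‖ ^ s) ^ r / ‖z.1 - z.2‖ ^ (n : ℝ) := fun r => by
      rw [Real.div_rpow (abs_nonneg _) (by positivity), ← Real.rpow_mul h.le, Real.rpow_add h,
        div_div, mul_comm]
    rw [key, key, key, ← add_div]
    gcongr
    set t := |u z.1 - u z.2| / ‖z.1 - z.2‖ ^ s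
    have ht : 0 ≤ t := by positivity
    rcases le_total t 1 with h1 | h1
    · exact (Real.rpow_le_rpow_of_exponent_ge' ht h1 zero_le_one hp1).trans
        (le_add_of_nonneg_right (by positivity))
    · exact (Real.rpow_le_rpow_of_exponent_le h1 hpq).trans
        (le_add_of_nonneg_left (by positivity))

/-- If `u` has finite energies of orders `1` and `q > 1`, its energies are right-continuous in the
exponent at `1`. -/
theorem tendsto_energyOn {n : ℕ} {S : Set (EuclideanSpace ℝ (Fin n) × EuclideanSpace ℝ (Fin n))}
    {s q : ℝ} (hs0 : 0 < s) (hq : 1 < q) {u : EuclideanSpace ℝ (Fin n) → ℝ} (hu : AEMeasurable u)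
    (h1 : ∫⁻ z in S, gagliardoIntegrand s 1 u z < ∞)
    (h2 : ∫⁻ z in S, gagliardoIntegrand s q u z < ∞) {p : ℕ → ℝ}
    (hp : Tendsto p atTop (𝓝[>] 1)) :
    Tendsto (fun k => energyOn S s (p k) u) atTop (𝓝 (energyOn S s 1 u)) := by
  obtain ⟨hp', hp1⟩ := tendsto_nhdsWithin_iff.1 hp
  have hm : ∀ r, AEMeasurable (gagliardoIntegrand s r u) (volume.restrict S) :=
    fun r => (aemeasurable_gagliardoIntegrand s r hu).restrict
  refine ENNReal.Tendsto.mul (tendsto_ofReal_one_div_two_mul hp') (Or.inr h1.ne) ?_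
    (Or.inr ENNReal.ofReal_ne_top)
  refine tendsto_lintegral_filter_of_dominated_convergence'
    (fun z => gagliardoIntegrand s 1 u z + gagliardoIntegrand s q u z)
    (Eventually.of_forall fun k => hm _) ?_ ?_ (ae_of_all _ fun z =>
      tendsto_gagliardoIntegrand hp' tendsto_const_nhds tendsto_const_nhds)
  · filter_upwards [hp1, hp'.eventually_le_const hq] with k hk1 hk2
    exact ae_of_all _ (gagliardoIntegrand_le_add hs0 (le_of_lt hk1) hk2 u)
  · rw [lintegral_add_left' (hm 1)]
    exact (ENNReal.add_lt_top.2 ⟨h1, h2⟩).ne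

/-- Diagonal selection: if each `P j` holds eventually, then `P (φ k) k` holds eventually for some
`φ` tending to infinity. -/
theorem exists_tendsto_atTop_eventually_diag {P : ℕ → ℕ → Prop} (h : ∀ j, ∀ᶠ k in atTop, P j k) :
    ∃ φ : ℕ → ℕ, Tendsto φ atTop atTop ∧ ∀ᶠ k in atTop, P (φ k) k := by
  classical
  have h' : ∀ j, ∃ N, ∀ k ≥ N, P j k := fun j => eventually_atTop.1 (h j)
  choose N hN using h'
  -- `φ k` is the largest `j ≤ k` whose threshold `N j` has been reached. Its default value 0 is
  -- legitimate once `N 0 ≤ k`.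
  refine ⟨fun k => Nat.findGreatest (fun j => N j ≤ k) k, ?_, ?_⟩
  · refine tendsto_atTop.2 fun j => ?_
    filter_upwards [eventually_ge_atTop (max j (N j))] with k hk
    exact Nat.le_findGreatest ((le_max_left _ _).trans hk) ((le_max_right _ _).trans hk)
  · filter_upwards [eventually_ge_atTop (N 0)] with k hk
    exact hN _ k (Nat.findGreatest_spec (P := fun j => N j ≤ k) (Nat.zero_le k) hk)

/-! ### Truncation and recovery sequences -/

theorem abs_clamp_sub_clamp_le (m a b : ℝ) :
    |max (-m) (min m a) - max (-m) (min m b)| ≤ |a - b| := by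
  refine (abs_max_sub_max_le_max _ _ _ _).trans ?_
  rw [sub_self, abs_zero, max_eq_right (abs_nonneg _)]
  refine (abs_min_sub_min_le_max _ _ _ _).trans ?_
  rw [sub_self, abs_zero, max_eq_right (abs_nonneg _)]

theorem abs_clamp_le {m : ℝ} (hm : 0 ≤ m) (a : ℝ) : |max (-m) (min m a)| ≤ m :=
  abs_le.2 ⟨le_max_left _ _, max_le (by linarith) (min_le_left _ _)⟩

theorem gagliardoIntegral_clamp_le {n : ℕ} (Ω : Set (EuclideanSpace ℝ (Fin n))) (s m : ℝ)
    (u : EuclideanSpace ℝ (Fin n) → ℝ) :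
    gagliardoIntegral Ω s 1 (fun x => max (-m) (min m (u x))) ≤ gagliardoIntegral Ω s 1 u := by
  refine lintegral_mono fun z => ENNReal.ofReal_le_ofReal ?_
  simp only [Real.rpow_one]
  exact div_le_div_of_nonneg_right (abs_clamp_sub_clamp_le _ _ _) (by positivity)

theorem gagliardoIntegral_congr_ae {n : ℕ} (Ω : Set (EuclideanSpace ℝ (Fin n))) (s q : ℝ)
    {u v : EuclideanSpace ℝ (Fin n) → ℝ} (h : u =ᵐ[volume] v) :
    gagliardoIntegral Ω s q u = gagliardoIntegral Ω s q v := by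
  refine lintegral_congr_ae (ae_restrict_of_ae ?_)
  rw [Measure.volume_eq_prod]
  filter_upwards [Measure.quasiMeasurePreserving_fst.ae h, Measure.quasiMeasurePreserving_snd.ae h]
    with z h1 h2
  rw [h1, h2]

theorem tendsto_setLIntegral_clamp_sub {n : ℕ} {u : EuclideanSpace ℝ (Fin n) → ℝ}
    (hu : Measurable u) {K : Set (EuclideanSpace ℝ (Fin n))} (hint : IntegrableOn u K) :
    Tendsto (fun j : ℕ => ∫⁻ x in K, ‖max (-(j : ℝ)) (min (j : ℝ) (u x)) - u x‖ₑ) atTop (𝓝 0) := by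
  have h : Tendsto (fun j : ℕ => ∫⁻ x in K, ‖max (-(j : ℝ)) (min (j : ℝ) (u x)) - u x‖ₑ) atTop
      (𝓝 (∫⁻ _x in K, 0)) := by
    refine tendsto_lintegral_filter_of_dominated_convergence' (fun x => 2 * ‖u x‖ₑ)
      (Eventually.of_forall fun j => by fun_prop)
      (Eventually.of_forall fun j => ae_of_all _ fun x => ?_) ?_ (ae_of_all _ fun x => ?_)
    · have h1 : |max (-(j : ℝ)) (min (j : ℝ) (u x))| ≤ |u x| := by
        have := abs_clamp_sub_clamp_le j (u x) 0
        simpa using this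
      rw [← ofReal_norm, ← ofReal_norm, ← ENNReal.ofReal_ofNat, ← ENNReal.ofReal_mul zero_le_two]
      refine ENNReal.ofReal_le_ofReal ((norm_sub_le _ _).trans ?_)
      simp only [Real.norm_eq_abs]
      linarith
    · rw [lintegral_const_mul _ hu.enorm]
      exact ENNReal.mul_ne_top ENNReal.ofNat_ne_top hint.2.ne
    · obtain ⟨N, hN⟩ := exists_nat_ge |u x|
      refine tendsto_const_nhds.congr' ?_
      filter_upwards [eventually_ge_atTop N] with j hj
      have hj' : |u x| ≤ j := hN.trans (by exact_mod_cast hj)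
      rw [min_eq_right (abs_le.1 hj').2, max_eq_right (abs_le.1 hj').1, sub_self, enorm_zero]
  rwa [lintegral_zero] at h

/-- Every function of finite `(s,1)`-energy is approximated in `L¹_loc` and in energy by functions
of finite `(s,p)`-energy for some `p > 1`. -/
theorem exists_seq_approximation {n : ℕ} {Ω : Set (EuclideanSpace ℝ (Fin n))} (hn : 0 < n)
    (hlip : HasLipschitzBoundary Ω) (hΩ : IsOpen Ω) (hb : Bornology.IsBounded Ω) {s : ℝ}
    (hs0 : 0 < s) (hs1 : s < 1) (u : L1Loc n) (hfin : gagliardoIntegral Ω s 1 u.toFun < ∞) :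
    ∃ v : ℕ → L1Loc n, Tendsto v atTop (𝓝 u) ∧
      (∀ j : ℕ, gagliardoIntegral Ω s 1 (v j).toFun ≤
        gagliardoIntegral Ω s 1 u.toFun + ((j : ℝ≥0∞) + 1)⁻¹) ∧
      ∀ j, ∃ q > 1, gagliardoIntegral Ω s q (v j).toFun < ∞ := by
  set g := u.aemeasurable.mk u.toFun
  have hg : Measurable g := u.aemeasurable.measurable_mk
  have hug : u.toFun =ᵐ[volume] g := u.aemeasurable.ae_eq_mk
  set w : ℕ → EuclideanSpace ℝ (Fin n) → ℝ := fun j x => max (-(j : ℝ)) (min (j : ℝ) (g x))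
  have hwG : ∀ j, gagliardoIntegral Ω s 1 (w j) ≤ gagliardoIntegral Ω s 1 u.toFun := fun j =>
    (gagliardoIntegral_clamp_le Ω s j g).trans_eq (gagliardoIntegral_congr_ae Ω s 1 hug).symm
  have hwm : ∀ j, Measurable (w j) := fun j => by fun_prop
  have hex : ∀ j : ℕ, ∃ v : L1Loc n, ∫⁻ x, ‖v.toFun x - w j x‖ₑ ≤ ((j : ℝ≥0∞) + 1)⁻¹ ∧
      gagliardoIntegral Ω s 1 v.toFun ≤ gagliardoIntegral Ω s 1 (w j) + ((j : ℝ≥0∞) + 1)⁻¹ ∧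
      ∃ p > 1, gagliardoIntegral Ω s p v.toFun < ∞ := fun j =>
    exists_approximation_of_abs_le hn hlip hΩ hb hs0 hs1 (hwm j)
      (fun x => abs_clamp_le j.cast_nonneg (g x)) ((hwG j).trans_lt hfin)
      (ENNReal.inv_ne_zero.2 (by finiteness))
  choose v hv1 hv2 hv3 using hex
  refine ⟨v, L1Loc.tendsto_iff.2 fun K hK => ?_, fun j => (hv2 j).trans (by gcongr; exact hwG j), hv3⟩
  have hgK : IntegrableOn g K := (u.locallyIntegrable.integrableOn_isCompact hK).congr
    (ae_restrict_of_ae hug)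
  have hinv : Tendsto (fun j : ℕ => ((j : ℝ≥0∞) + 1)⁻¹) atTop (𝓝 0) := by
    have := (ENNReal.tendsto_inv_nat_nhds_zero).comp (tendsto_add_atTop_nat 1)
    refine this.congr fun j => ?_
    simp
  have hsum := hinv.add (tendsto_setLIntegral_clamp_sub hg hgK)
  rw [add_zero] at hsum
  refine tendsto_of_tendsto_of_tendsto_of_le_of_le tendsto_const_nhds hsum (fun _ => zero_le)
    fun j => ?_
  calc ∫⁻ x in K, ‖(v j).toFun x - u.toFun x‖ₑ
      ≤ ∫⁻ x in K, (‖(v j).toFun x - w j x‖ₑ + ‖w j x - g x‖ₑ) := by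
        refine lintegral_mono_ae (ae_restrict_of_ae ?_)
        filter_upwards [hug] with x hx
        rw [hx, ← sub_add_sub_cancel _ (w j x)]
        exact enorm_add_le _ _
    _ = (∫⁻ x in K, ‖(v j).toFun x - w j x‖ₑ) + ∫⁻ x in K, ‖w j x - g x‖ₑ :=
        lintegral_add_right _ ((hwm j).sub hg).enorm
    _ ≤ _ := add_le_add ((setLIntegral_le_lintegral _ _).trans (hv1 j)) le_rfl

/-- In dimension zero every pair is diagonal. The case is separated because the radial kernel
estimate needs `0 < n`. -/
theorem energyOn_eq_zero_of_dim_eq_zero {n : ℕ} (hn : n = 0)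
    (S : Set (EuclideanSpace ℝ (Fin n) × EuclideanSpace ℝ (Fin n))) (s : ℝ) {q : ℝ} (hq : q ≠ 0)
    (u : EuclideanSpace ℝ (Fin n) → ℝ) : energyOn S s q u = 0 := by
  subst hn
  have : ∀ z, gagliardoIntegrand s q u z = 0 := fun z => by
    simp [gagliardoIntegrand, Subsingleton.elim z.1 z.2, hq]
  simp [energyOn, this]

/-- Existence of recovery sequences. -/
theorem exists_recovery_sequence {n : ℕ} {Ω : Set (EuclideanSpace ℝ (Fin n))}
    (hlip : HasLipschitzBoundary Ω) (hΩ : IsOpen Ω) (hb : Bornology.IsBounded Ω) {s : ℝ}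
    (hs0 : 0 < s) (hs1 : s < 1) {p : ℕ → ℝ} (hp : Tendsto p atTop (𝓝[>] 1)) (u : L1Loc n) :
    ∃ w : ℕ → L1Loc n, Tendsto w atTop (𝓝 u) ∧
      limsup (fun k => energyOn (Q Ω) s (p k) (w k).toFun) atTop ≤ energyOn (Q Ω) s 1 u.toFun := by
  have hp1 : ∀ᶠ k in atTop, 1 < p k := (tendsto_nhdsWithin_iff.1 hp).2
  rcases Nat.eq_zero_or_pos n with hn | hn
  · refine ⟨fun _ => u, tendsto_const_nhds, limsup_le_of_le (h := ?_)⟩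
    filter_upwards [hp1] with k hk
    rw [energyOn_eq_zero_of_dim_eq_zero hn _ _ (by positivity)]
    exact zero_le
  rcases eq_or_ne (gagliardoIntegral Ω s 1 u.toFun) ∞ with hinf | hfin
  · refine ⟨fun _ => u, tendsto_const_nhds, ?_⟩
    have : energyOn (Q Ω) s 1 u.toFun = ∞ := by
      rw [energyOn, ← gagliardoIntegral_eq, hinf, ENNReal.mul_top (by simp)]
    rw [this]
    exact le_top
  obtain ⟨v, hv, hvG, hvq⟩ := exists_seq_approximation hn hlip hΩ hb hs0 hs1 u hfin.lt_top
  have hinv : Tendsto (fun j : ℕ => ((j : ℝ≥0∞) + 1)⁻¹) atTop (𝓝 0) := by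
    have := (ENNReal.tendsto_inv_nat_nhds_zero).comp (tendsto_add_atTop_nat 1)
    refine this.congr fun j => ?_
    simp
  have hinv_ne : ∀ j : ℕ, ((j : ℝ≥0∞) + 1)⁻¹ ≠ 0 := fun j => ENNReal.inv_ne_zero.2 (by finiteness)
  have hvfin : ∀ j, gagliardoIntegral Ω s 1 (v j).toFun < ∞ := fun j =>
    (hvG j).trans_lt (ENNReal.add_lt_top.2 ⟨hfin.lt_top, by simp⟩)
  -- For fixed `j` the energies of `v j` converge as `p k → 1`; the index `j = φ k` grows slowly
  -- enough that the error stays below `1/(j + 1)`.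
  obtain ⟨φ, hφ, hφk⟩ := exists_tendsto_atTop_eventually_diag
    (P := fun j k => energyOn (Q Ω) s (p k) (v j).toFun ≤
      energyOn (Q Ω) s 1 (v j).toFun + ((j : ℝ≥0∞) + 1)⁻¹) fun j => by
    obtain ⟨q, hq, hqfin⟩ := hvq j
    exact eventually_le_add_of_tendsto
      (tendsto_energyOn hs0 hq (v j).aemeasurable (hvfin j) hqfin hp)
      (ENNReal.mul_ne_top ENNReal.ofReal_ne_top (hvfin j).ne) (hinv_ne j)
  refine ⟨fun k => v (φ k), hv.comp hφ, ?_⟩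
  set c := ENNReal.ofReal (1 / (2 * 1))
  have hlim : Tendsto (fun j : ℕ => c * (gagliardoIntegral Ω s 1 u.toFun + ((j : ℝ≥0∞) + 1)⁻¹) +
      ((j : ℝ≥0∞) + 1)⁻¹) atTop (𝓝 (energyOn (Q Ω) s 1 u.toFun)) := by
    have h1 := (ENNReal.Tendsto.const_mul (a := c)
      ((tendsto_const_nhds (x := gagliardoIntegral Ω s 1 u.toFun)).add hinv)
      (Or.inr ENNReal.ofReal_ne_top)).add hinv
    rw [add_zero, add_zero] at h1
    exact h1
  rw [← (hlim.comp hφ).limsup_eq]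
  refine limsup_le_limsup ?_
  filter_upwards [hφk] with k hk
  refine hk.trans ?_
  simp only [Function.comp_apply]
  gcongr
  exact mul_le_mul_right (hvG (φ k)) c

end FracGagliardo

/-! ### Γ-convergence -/

theorem theorem1p4 {n : ℕ} (Ω : Set (EuclideanSpace ℝ (Fin n))) (hΩ_open : IsOpen Ω)
    (hΩ_bdd : Bornology.IsBounded Ω) (hΩ_lip : FracGagliardo.HasLipschitzBoundary Ω)
    (s : ℝ) (hs0 : 0 < s) (hs1 : s < 1) :
    FracGagliardo.GammaTendsto
      (fun (p : ℝ) (u : FracGagliardo.L1Loc n) => FracGagliardo.extEnergy Ω s p u)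
      (𝓝[>] (1 : ℝ))
      (fun u : FracGagliardo.L1Loc n => FracGagliardo.extEnergy Ω s 1 u) := by
  intro p hp
  obtain ⟨hp', hp1⟩ := tendsto_nhdsWithin_iff.1 hp
  -- Convergence to `𝓝[>] 1` gives `p k > 1` only eventually, hence an eventual equality of
  -- energies.
  have hE : ∀ u : ℕ → FracGagliardo.L1Loc n,
      (fun k => FracGagliardo.energyOn (FracGagliardo.Q Ω) s (p k) (u k).toFun) =ᶠ[atTop]
        fun k => FracGagliardo.extEnergy Ω s (p k) (u k) := fun u => by
    filter_upwards [hp1] with k hk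
    exact (FracGagliardo.extEnergy_eq_energyOn Ω s (one_pos.trans hk) _).symm
  simp only [FracGagliardo.extEnergy_eq_energyOn Ω s one_pos]
  refine ⟨fun x u hu => ?_, fun x => ?_⟩
  · rw [← liminf_congr (hE u)]
    exact FracGagliardo.energyOn_le_liminf _ hp' hu
  · obtain ⟨w, hw, hlimsup⟩ :=
      FracGagliardo.exists_recovery_sequence hΩ_lip hΩ_open hΩ_bdd hs0 hs1 hp x
    exact ⟨w, hw, (tendsto_of_le_liminf_of_limsup_le (FracGagliardo.energyOn_le_liminf _ hp' hw)
      hlimsup).congr' (hE w)⟩
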